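/- Let $0<q<1$ and $\lambda\in\mathbb{C}$ with $|\lambda|=1$. Let $\mathcal{A}_2^q$ be the unital complex $*$-algebra generated by $a_1,a_2$ with the relations $$a_i^*a_i=1+q\,a_ia_i^*\quad(i=1,2),\qquad a_1^*a_2=\lambda a_2a_1^*.$$ Let $\mathcal{H}=\mathbb{C}\langle e_1,e_2\rangle$, and define $T$ on $\mathcal{H}\otimes\mathcal{H}$ by $$T(e_i\otimes e_i)=q\,e_i\otimes e_i\ (i=1,2),\qquad T(e_1\otimes e_2)=\overline{\lambda}\,e_2\otimes e_1,\qquad T(e_2\otimes e_1)=\lambda\,e_1\otimes e_2 .$$ On $\mathcal{H}^{\otimes n}$ let $T_i$ $(1\le i\le n-1)$ be $T$ acting on the tensor factors $i$ and $i+1$. Let $R_2=1+T_1$, and define subspaces $\mathcal{K}_m\subset\mathcal{H}^{\otimes m}$ by $$\mathcal{K}_2=\ker R_2,\qquad \mathcal{K}_{m+1}=(1-T_1T_2\cdots T_m)(\mathcal{K}_m\otimes\mathcal{H})\quad(m\ge 2).$$ Elements of $\mathcal{H}^{\otimes m}$ are identified with homogeneous polynomials of degree $m$ in $a_1,a_2$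 through $e_{i_1}\otimes\cdots\otimes e_{i_m}\mapsto a_{i_1}\cdots a_{i_m}\in\mathcal{A}_2^q$. A (possibly unbounded) $*$-representation of $\mathcal{A}_2^q$ on a complex Hilbert space $H$ is a unital homomorphism $\pi$ from $\mathcal{A}_2^q$ to the algebra of linear operators on a dense subspace $D\subset H$ such that $\langle\pi(x)\varphi,\psi\rangle=\langle\varphi,\pi(x^*)\psi\rangle$ for all $x\in\mathcal{A}_2^q$ and $\varphi,\psi\in D$. It is irreducible if $H\ne\{0\}$ and $0$ and $1$ are the only orthogonal projections $P$ on $H$ with $PD\subset D$ and $P\pi(x)\varphi=\pi(x)P\varphi$ for all $x\in\mathcal{A}_2^q$, $\varphi\in D$; equivalently, if $\pi$ is not a direct sum of two $*$-representations on nonzero Hilbert spaces. Let $\pi$ be an irreducible (possibly unbounded) $*$-representation of $\mathcal{A}_2^q$ such that $\pi(\mathcal{K}_m)=\{0\}$ for some $m\ge 3$. Then $\pi(A)=0$, where $A=a_2a_1-\lambda a_1a_2$, and hence $\pi(\mathcal{K}_2)=\{0\}$. -/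

import Mathlib

/-! ### Tensor powers in coordinates and the subspaces `K_m` of a Wick algebra -/

/-- The tensor power `H^{⊗n}` of `H = ℂ⟨e_1, …, e_d⟩`, with basis the words
`e_{w 0} ⊗ ⋯ ⊗ e_{w (n-1)}`, which are `Finsupp.single w 1`. -/
abbrev WickTensor (d n : ℕ) : Type := (Fin n → Fin d) →₀ ℂ

/-- The operator `1 ⊗ ⋯ ⊗ 1 ⊗ T ⊗ 1 ⊗ ⋯ ⊗ 1` on `H^{⊗(n+1)}`, with `T` acting on the neighbouring
tensor factors number `i` and `i + 1`. Here `T` is an operator on `H ⊗ H`, whose basis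
vector `e_k ⊗ e_l` is `Finsupp.single (k, l) 1`. -/
noncomputable def wickExt {d : ℕ} (T : Module.End ℂ ((Fin d × Fin d) →₀ ℂ)) {n : ℕ} (i : Fin n) :
    Module.End ℂ (WickTensor d (n + 1)) :=
  Finsupp.linearCombination ℂ fun w : Fin (n + 1) → Fin d =>
    Finsupp.mapDomain
      (fun p : Fin d × Fin d =>
        Function.update (Function.update w i.castSucc p.1) i.succ p.2)
      (T (Finsupp.single (w i.castSucc, w i.succ) 1))

/-- The product `T_1 T_2 ⋯ T_k` on `H^{⊗(n+1)}`, for `k ≤ n`. -/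
noncomputable def wickProd {d : ℕ} (T : Module.End ℂ ((Fin d × Fin d) →₀ ℂ)) (n k : ℕ) :
    Module.End ℂ (WickTensor d (n + 1)) :=
  ((List.ofFn fun i : Fin n => wickExt T i).take k).prod

/-- The operator `R_{n+1} = 1 + T_1 + T_1 T_2 + ⋯ + T_1 T_2 ⋯ T_n` on `H^{⊗(n+1)}`. -/
noncomputable def wickR {d : ℕ} (T : Module.End ℂ ((Fin d × Fin d) →₀ ℂ)) (n : ℕ) :
    Module.End ℂ (WickTensor d (n + 1)) :=
  ∑ k ∈ Finset.range (n + 1), wickProd T n k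

/-- The map `X ↦ X ⊗ e_j` from `H^{⊗n}` to `H^{⊗(n+1)}`. -/
noncomputable def wickAppend {d n : ℕ} (j : Fin d) : WickTensor d n →ₗ[ℂ] WickTensor d (n + 1) :=
  Finsupp.lmapDomain ℂ ℂ fun w : Fin n → Fin d => Fin.snoc (α := fun _ => Fin d) w j

/-- The subspace `K ⊗ H` of `H^{⊗(n+1)}`, for a subspace `K` of `H^{⊗n}`. -/
noncomputable def wickTensorRight {d n : ℕ} (K : Submodule ℂ (WickTensor d n)) :
    Submodule ℂ (WickTensor d (n + 1)) :=
  ⨆ j : Fin d, K.map (wickAppend j)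

/-- The subspaces `K_m` of `H^{⊗m}`: `K_2 = ker R_2` and
`K_{m+1} = (1 - T_1 T_2 ⋯ T_m) (K_m ⊗ H)` for `m ≥ 2`; the values at `0` and `1` are not used. -/
noncomputable def wickK {d : ℕ} (T : Module.End ℂ ((Fin d × Fin d) →₀ ℂ)) :
    (m : ℕ) → Submodule ℂ (WickTensor d m)
  | 0 => ⊥
  | 1 => ⊥
  | 2 => LinearMap.ker (wickR T 1)
  | m + 3 => (wickTensorRight (wickK T (m + 2))).map (1 - wickProd T (m + 2) (m + 2))

/-- The operator `T` of the quon relations with two degrees of freedom: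
`T (e_i ⊗ e_i) = q e_i ⊗ e_i`, `T (e_1 ⊗ e_2) = conj lam e_2 ⊗ e_1`,
`T (e_2 ⊗ e_1) = lam e_1 ⊗ e_2`. The indices `1, 2` are `0, 1 : Fin 2`. -/
noncomputable def quonT (q : ℝ) (lam : ℂ) : Module.End ℂ ((Fin 2 × Fin 2) →₀ ℂ) :=
  Finsupp.linearCombination ℂ fun p : Fin 2 × Fin 2 =>
    Finsupp.single (p.2, p.1)
      (if p.1 = p.2 then (q : ℂ) else if p.1 = 0 then (starRingEnd ℂ) lam else lam)

/-! ### The `*`-algebra of the quon relations -/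

/-- The letters `a_1, a_2, a_1^*, a_2^*`. -/
inductive QuonGen : Type
  | a (i : Fin 2)
  | aStar (i : Fin 2)

/-- The involution of the letters that exchanges `a_i` and `a_i^*`. -/
def QuonGen.swap : QuonGen → QuonGen
  | .a i => .aStar i
  | .aStar i => .a i

/-- The quon relations `a_i^* a_i = 1 + q a_i a_i^*` and `a_1^* a_2 = lam a_2 a_1^*`, together with
the adjoint `a_2^* a_1 = conj lam a_1 a_2^*` of the latter. -/
inductive QuonRel (q : ℝ) (lam : ℂ) : FreeAlgebra ℂ QuonGen → FreeAlgebra ℂ QuonGen → Prop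
  | diag (i : Fin 2) : QuonRel q lam
      (FreeAlgebra.ι ℂ (.aStar i) * FreeAlgebra.ι ℂ (.a i))
      (1 + (q : ℂ) • (FreeAlgebra.ι ℂ (.a i) * FreeAlgebra.ι ℂ (.aStar i)))
  | off : QuonRel q lam
      (FreeAlgebra.ι ℂ (.aStar 0) * FreeAlgebra.ι ℂ (.a 1))
      (lam • (FreeAlgebra.ι ℂ (.a 1) * FreeAlgebra.ι ℂ (.aStar 0)))
  | offStar : QuonRel q lam
      (FreeAlgebra.ι ℂ (.aStar 1) * FreeAlgebra.ι ℂ (.a 0))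
      ((starRingEnd ℂ) lam • (FreeAlgebra.ι ℂ (.a 0) * FreeAlgebra.ι ℂ (.aStar 1)))

/-- The algebra `A_2^q` generated by `a_i, a_i^*`, `i = 1, 2`, with the quon relations. -/
def QuonAlgebra (q : ℝ) (lam : ℂ) : Type := RingQuot (QuonRel q lam)

noncomputable instance QuonAlgebra.instRing (q : ℝ) (lam : ℂ) : Ring (QuonAlgebra q lam) :=
  inferInstanceAs (Ring (RingQuot (QuonRel q lam)))

noncomputable instance QuonAlgebra.instAlgebra (q : ℝ) (lam : ℂ) :
    Algebra ℂ (QuonAlgebra q lam) :=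
  inferInstanceAs (Algebra ℂ (RingQuot (QuonRel q lam)))

/-- The image of a letter in `A_2^q`. -/
noncomputable def QuonAlgebra.gen (q : ℝ) (lam : ℂ) (g : QuonGen) : QuonAlgebra q lam :=
  RingQuot.mkAlgHom ℂ (QuonRel q lam) (FreeAlgebra.ι ℂ g)

/-- The generator `a_i` of `A_2^q`. -/
noncomputable def QuonAlgebra.a (q : ℝ) (lam : ℂ) (i : Fin 2) : QuonAlgebra q lam :=
  QuonAlgebra.gen q lam (.a i)

/-- The opposite ring of a complex algebra `A`, with the conjugate action of the scalars: an algebra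
homomorphism into it is a conjugate-linear anti-homomorphism into `A`. -/
def ConjOpposite (A : Type*) : Type _ := Aᵐᵒᵖ

noncomputable instance ConjOpposite.instRing (A : Type*) [Ring A] : Ring (ConjOpposite A) :=
  inferInstanceAs (Ring Aᵐᵒᵖ)

noncomputable instance ConjOpposite.instAlgebra (A : Type*) [Ring A] [Algebra ℂ A] :
    Algebra ℂ (ConjOpposite A) :=
  RingHom.toAlgebra' ((algebraMap ℂ Aᵐᵒᵖ).comp (starRingEnd ℂ)) fun c x =>
    Algebra.commutes (A := Aᵐᵒᵖ) ((starRingEnd ℂ) c) x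

/-- The element `x` of `A`, as an element of `ConjOpposite A`. -/
def ConjOpposite.op {A : Type*} (x : A) : ConjOpposite A := MulOpposite.op x

/-- An element of `ConjOpposite A`, as an element of `A`. -/
def ConjOpposite.unop {A : Type*} (x : ConjOpposite A) : A := MulOpposite.unop x

theorem ConjOpposite.unop_smul {A : Type*} [Ring A] [Algebra ℂ A] (c : ℂ) (x : ConjOpposite A) :
    (c • x).unop = (starRingEnd ℂ) c • x.unop := by
  have h : c • x = algebraMap ℂ (ConjOpposite A) c * x := Algebra.smul_def c x
  rw [h, Algebra.smul_def, Algebra.commutes]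
  rfl

theorem ConjOpposite.unop_algebraMap {A : Type*} [Ring A] [Algebra ℂ A] (c : ℂ) :
    (algebraMap ℂ (ConjOpposite A) c).unop = algebraMap ℂ A ((starRingEnd ℂ) c) := rfl

theorem QuonAlgebra.gen_diag (q : ℝ) (lam : ℂ) (i : Fin 2) :
    gen q lam (.aStar i) * gen q lam (.a i) =
      1 + (q : ℂ) • (gen q lam (.a i) * gen q lam (.aStar i)) := by
  have h := RingQuot.mkAlgHom_rel ℂ (QuonRel.diag (q := q) (lam := lam) i)
  simp only [map_mul, map_add, map_one, map_smul] at h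
  exact h

theorem QuonAlgebra.gen_off (q : ℝ) (lam : ℂ) :
    gen q lam (.aStar 0) * gen q lam (.a 1) =
      lam • (gen q lam (.a 1) * gen q lam (.aStar 0)) := by
  have h := RingQuot.mkAlgHom_rel ℂ (QuonRel.off (q := q) (lam := lam))
  simp only [map_mul, map_smul] at h
  exact h

theorem QuonAlgebra.gen_offStar (q : ℝ) (lam : ℂ) :
    gen q lam (.aStar 1) * gen q lam (.a 0) =
      (starRingEnd ℂ) lam • (gen q lam (.a 0) * gen q lam (.aStar 1)) := by
  have h := RingQuot.mkAlgHom_rel ℂ (QuonRel.offStar (q := q) (lam := lam))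
  simp only [map_mul, map_smul] at h
  exact h

/-- The involution of `A_2^q`, as a conjugate-linear anti-homomorphism: it exchanges `a_i`
and `a_i^*`. -/
noncomputable def QuonAlgebra.starHom (q : ℝ) (lam : ℂ) :
    QuonAlgebra q lam →ₐ[ℂ] ConjOpposite (QuonAlgebra q lam) :=
  RingQuot.liftAlgHom ℂ
    ⟨FreeAlgebra.lift ℂ fun g => ConjOpposite.op (gen q lam g.swap), by
      intro x y h
      apply MulOpposite.unop_injective
      induction h with
      | diag i =>
        simp only [map_mul, map_add, map_one, map_smul, FreeAlgebra.lift_ι_apply]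
        refine (gen_diag q lam i).trans ?_
        refine congrArg (fun z => 1 + z) ?_
        refine Eq.trans ?_ (ConjOpposite.unop_smul _ _).symm
        rw [Complex.conj_ofReal]
        rfl
      | off =>
        simp only [map_mul, map_smul, FreeAlgebra.lift_ι_apply]
        exact (gen_offStar q lam).trans (ConjOpposite.unop_smul _ _).symm
      | offStar =>
        simp only [map_mul, map_smul, FreeAlgebra.lift_ι_apply]
        refine (gen_off q lam).trans ?_
        refine Eq.trans ?_ (ConjOpposite.unop_smul _ _).symm
        rw [Complex.conj_conj]
        rfl⟩

theorem QuonAlgebra.starHom_gen (q : ℝ) (lam : ℂ) (g : QuonGen) :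
    (starHom q lam (gen q lam g)).unop = gen q lam g.swap := by
  have h : starHom q lam (gen q lam g) = ConjOpposite.op (gen q lam g.swap) := by
    refine (RingQuot.liftAlgHom_mkAlgHom_apply ℂ _ _ _).trans ?_
    exact FreeAlgebra.lift_ι_apply _ _
  rw [h]
  rfl

/-- `A_2^q` is generated by the letters as a complex algebra. -/
theorem QuonAlgebra.induction {q : ℝ} {lam : ℂ} {P : QuonAlgebra q lam → Prop}
    (halg : ∀ c : ℂ, P (algebraMap ℂ _ c)) (hgen : ∀ g, P (gen q lam g))
    (hmul : ∀ x y, P x → P y → P (x * y)) (hadd : ∀ x y, P x → P y → P (x + y))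
    (x : QuonAlgebra q lam) : P x := by
  obtain ⟨y, rfl⟩ := RingQuot.mkAlgHom_surjective ℂ (QuonRel q lam) x
  induction y using FreeAlgebra.induction with
  | grade0 c => rw [AlgHom.commutes]; exact halg c
  | grade1 g => exact hgen g
  | mul a b ha hb => rw [map_mul]; exact hmul _ _ ha hb
  | add a b ha hb => rw [map_add]; exact hadd _ _ ha hb

noncomputable instance QuonAlgebra.instStarRing (q : ℝ) (lam : ℂ) :
    StarRing (QuonAlgebra q lam) where
  star x := (starHom q lam x).unop
  star_add x y := by rw [map_add]; rfl
  star_mul x y := by rw [map_mul]; rfl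
  star_involutive x := by
    change (starHom q lam (starHom q lam x).unop).unop = x
    induction x using QuonAlgebra.induction with
    | halg c =>
      rw [AlgHom.commutes, ConjOpposite.unop_algebraMap, AlgHom.commutes,
        ConjOpposite.unop_algebraMap, Complex.conj_conj]
    | hgen g =>
      rw [starHom_gen, starHom_gen]
      cases g <;> rfl
    | hmul x y hx hy =>
      have h : (starHom q lam (x * y)).unop
          = (starHom q lam y).unop * (starHom q lam x).unop := by rw [map_mul]; rfl
      have h2 : ∀ u v : QuonAlgebra q lam, (starHom q lam (u * v)).unop
          = (starHom q lam v).unop * (starHom q lam u).unop := fun u v => by rw [map_mul]; rfl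
      rw [h, h2, hx, hy]
    | hadd x y hx hy =>
      have h2 : ∀ u v : QuonAlgebra q lam, (starHom q lam (u + v)).unop
          = (starHom q lam u).unop + (starHom q lam v).unop := fun u v => by rw [map_add]; rfl
      rw [h2, h2, hx, hy]

instance QuonAlgebra.instStarModule (q : ℝ) (lam : ℂ) : StarModule ℂ (QuonAlgebra q lam) where
  star_smul c x := by
    change (starHom q lam (c • x)).unop = _
    rw [map_smul]
    exact ConjOpposite.unop_smul _ _

theorem QuonAlgebra.star_gen (q : ℝ) (lam : ℂ) (g : QuonGen) :
    star (gen q lam g) = gen q lam g.swap := starHom_gen q lam g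

/-- The identification of `H^{⊗m}` with the homogeneous polynomials of degree `m` in `a_1, a_2`:
the linear map to `A_2^q` that sends `e_{i_1} ⊗ ⋯ ⊗ e_{i_m}` to `a_{i_1} ⋯ a_{i_m}`. -/
noncomputable def quonOfTensor (q : ℝ) (lam : ℂ) (m : ℕ) :
    WickTensor 2 m →ₗ[ℂ] QuonAlgebra q lam :=
  Finsupp.linearCombination ℂ fun w : Fin m → Fin 2 =>
    (List.ofFn fun i : Fin m => QuonAlgebra.a q lam (w i)).prod

/-- The element `A = a_2 a_1 - lam a_1 a_2` of `A_2^q`. -/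
noncomputable def quonA (q : ℝ) (lam : ℂ) : QuonAlgebra q lam :=
  QuonAlgebra.a q lam 1 * QuonAlgebra.a q lam 0 -
    lam • (QuonAlgebra.a q lam 0 * QuonAlgebra.a q lam 1)

/-! ### Unbounded `*`-representations -/

/-- A (possibly unbounded) `*`-representation of a complex unital `*`-algebra `A` on the Hilbert
space `H`: a unital homomorphism `π` from `A` to the linear operators on a dense subspace `D` of `H`
with `⟨π(x) φ, ψ⟩ = ⟨φ, π(x^*) ψ⟩` for all `x` in `A` and `φ, ψ` in `D`. -/
structure UnboundedStarRep (A : Type*) [Ring A] [Algebra ℂ A] [StarRing A]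
    (H : Type*) [NormedAddCommGroup H] [InnerProductSpace ℂ H] where
  domain : Submodule ℂ H
  dense_domain : Dense (domain : Set H)
  toAlgHom : A →ₐ[ℂ] Module.End ℂ domain
  inner_apply : ∀ (x : A) (φ ψ : domain),
    inner ℂ (toAlgHom x φ : H) (ψ : H) = inner ℂ (φ : H) (toAlgHom (star x) ψ : H)

/-- A `*`-representation on `H ≠ 0` is irreducible if it is not a direct sum of two
`*`-representations on nonzero Hilbert spaces; that is, if `0` and `1` are the only orthogonal
projections of `H` that map the domain to itself and commute there with all `π(x)`. -/
def UnboundedStarRep.IsIrreducible {A : Type*} [Ring A] [Algebra ℂ A] [StarRing A]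
    {H : Type*} [NormedAddCommGroup H] [InnerProductSpace ℂ H] [CompleteSpace H]
    (π : UnboundedStarRep A H) : Prop :=
  Nontrivial H ∧
    ∀ P : H →L[ℂ] H, IsStarProjection P →
      (∀ φ : π.domain, ∃ φ' : π.domain, (φ' : H) = P φ ∧
        ∀ x : A, (π.toAlgHom x φ' : H) = P (π.toAlgHom x φ)) →
      P = 0 ∨ P = 1

/-! Call a homogeneous polynomial `x` of multidegree `d` Wick commuting if `a_j^* x = w_j x a_j^*`
for each `j`, where `w_j` is a product of the coefficients of `T` and `|w_j| = q ^ d_j`. The element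
`A` is such a polynomial, of multidegree `(1, 1)`.

On `X ⊗ e_j` with `X` of multidegree `d`, the product `T_1 ⋯ T_m` is `w_j` times the move of `e_j`
to the front. So if `x` comes from `K_m`, then `x a_j - w_j a_j x` comes from `K_{m+1}`
(`quonCommutator_mem_wickK`), and it is Wick commuting again
(`QuonAlgebra.IsWickCommuting.commutator`).

If these commutators vanish under `π`, then `x` commutes up to scalars with every `a_j`, and so does
`x^*`, by the adjoint of the Wick relation. Moving `x` and `x^*` past the polynomial `x` gives `x² =
s x²` with `|s| = q ^ (∑ d_k²) < 1`, hence `x² = 0`, and `x^* x = c x x^*`. Then `(x^* x)²` is a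
multiple of `x² (x^*)² = 0`, and positivity forces `π(x) = 0`
(`UnboundedStarRep.toAlgHom_quonOfTensor_eq_zero`). Descending from `K_m` to `K_2` reaches `A`,
which spans `K_2`. -/

/-! ### The action of `T_1 ⋯ T_n` on words -/

/-- The scalar with `T (e_k ⊗ e_j) = quonCoeff k j • e_j ⊗ e_k`. -/
noncomputable def quonCoeff (q : ℝ) (lam : ℂ) (k j : Fin 2) : ℂ :=
  if k = j then (q : ℂ) else if k = 0 then (starRingEnd ℂ) lam else lam

theorem quonT_single (q : ℝ) (lam : ℂ) (k j : Fin 2) :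
    quonT q lam (Finsupp.single (k, j) 1) = Finsupp.single (j, k) (quonCoeff q lam k j) := by
  simp [quonT, quonCoeff, Finsupp.linearCombination_single]

theorem Fin.update_update_insertNth {α : Type*} {n : ℕ} (i : Fin n) (x : α) (w : Fin n → α) :
    Function.update (Function.update (i.succ.insertNth (α := fun _ => α) x w) i.castSucc x)
      i.succ (w i) = i.castSucc.insertNth (α := fun _ => α) x w := by
  funext l
  rcases Fin.eq_self_or_eq_succAbove i.castSucc l with rfl | ⟨k, rfl⟩
  · rw [Function.update_of_ne (ne_of_lt (Fin.castSucc_lt_succ (i := i))), Function.update_self,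
      Fin.insertNth_apply_same]
  · rw [Fin.insertNth_apply_succAbove]
    by_cases hk : k = i
    · subst hk
      rw [Fin.succAbove_castSucc_self, Function.update_self]
    · have h : i.castSucc.succAbove k = i.succ.succAbove k := by
        rcases lt_or_gt_of_ne hk with h | h
        · rw [Fin.succAbove_of_castSucc_lt _ _ (by simpa using h),
            Fin.succAbove_of_castSucc_lt _ _ ((Fin.castSucc_lt_castSucc_iff.2 h).trans
              Fin.castSucc_lt_succ)]
        · rw [Fin.succAbove_of_lt_succ _ _ ((Fin.castSucc_lt_castSucc_iff.2 h).trans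
              Fin.castSucc_lt_succ), Fin.succAbove_of_lt_succ _ _ (by simpa using h)]
      rw [Function.update_of_ne (by rw [h]; exact Fin.succAbove_ne _ _),
        Function.update_of_ne (Fin.succAbove_ne _ _), h, Fin.insertNth_apply_succAbove]

/-- Writing words as `insertNth` keeps the background word `w` fixed while `j` travels left one
place at a time, so the successive coefficients multiply without reindexing. -/
theorem wickExt_quonT_insertNth (q : ℝ) (lam : ℂ) {n : ℕ} (i : Fin n) (j : Fin 2)
    (w : Fin n → Fin 2) :
    wickExt (quonT q lam) i
        (Finsupp.single (i.succ.insertNth (α := fun _ => Fin 2) j w) 1) =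
      quonCoeff q lam (w i) j •
        Finsupp.single (i.castSucc.insertNth (α := fun _ => Fin 2) j w) 1 := by
  have h : i.succ.insertNth (α := fun _ => Fin 2) j w i.castSucc = w i := by
    have := Fin.insertNth_apply_succAbove (α := fun _ => Fin 2) i.succ j w i
    rwa [Fin.succAbove_succ_self] at this
  rw [wickExt, Finsupp.linearCombination_single, one_smul, h, Fin.insertNth_apply_same,
    quonT_single, Finsupp.mapDomain_single, Fin.update_update_insertNth, Finsupp.smul_single,
    smul_eq_mul, mul_one]

theorem wickProd_zero {d : ℕ} (T : Module.End ℂ ((Fin d × Fin d) →₀ ℂ)) (n : ℕ) :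
    wickProd T n 0 = 1 := by
  simp [wickProd]

theorem wickProd_succ {d : ℕ} (T : Module.End ℂ ((Fin d × Fin d) →₀ ℂ)) {n : ℕ} (i : Fin n) :
    wickProd T n (i + 1) = wickProd T n i * wickExt T i := by
  rw [wickProd, wickProd, List.prod_take_succ _ _ (by simp)]
  simp

/-- `T_1 ⋯ T_k` moves the letter `j` from position `k` to the front. -/
theorem wickProd_quonT_insertNth (q : ℝ) (lam : ℂ) {n : ℕ} (j : Fin 2) (w : Fin n → Fin 2)
    (k : Fin (n + 1)) :
    wickProd (quonT q lam) n k (Finsupp.single (k.insertNth (α := fun _ => Fin 2) j w) 1) =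
      (∏ i with Fin.castSucc i < k, quonCoeff q lam (w i) j) •
        Finsupp.single (Fin.cons (α := fun _ => Fin 2) j w) 1 := by
  induction k using Fin.induction with
  | zero => simp [wickProd_zero]
  | succ i ih =>
    have hs : (Finset.univ.filter fun l : Fin n => l.castSucc < i.succ) =
        insert i (Finset.univ.filter fun l : Fin n => l.castSucc < i.castSucc) := by
      ext l
      simp [Fin.castSucc_lt_succ_iff, le_iff_eq_or_lt]
    rw [Fin.val_succ, wickProd_succ, Module.End.mul_apply, wickExt_quonT_insertNth, map_smul,
      hs, Finset.prod_insert (by simp), mul_smul]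
    exact congrArg _ ih

theorem wickProd_quonT_snoc (q : ℝ) (lam : ℂ) {n : ℕ} (j : Fin 2) (w : Fin n → Fin 2) :
    wickProd (quonT q lam) n n (Finsupp.single (Fin.snoc (α := fun _ => Fin 2) w j) 1) =
      (∏ i, quonCoeff q lam (w i) j) • Finsupp.single (Fin.cons (α := fun _ => Fin 2) j w) 1 := by
  have h := wickProd_quonT_insertNth q lam j w (Fin.last n)
  simpa [Fin.insertNth_last', Fin.castSucc_lt_last] using h

/-! ### Multidegrees -/

/-- The tensors that are linear combinations of words with `d k` letters `k`, for each `k`. -/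
noncomputable def wickHomogeneous {b : ℕ} (m : ℕ) (d : Fin b → ℕ) :
    Submodule ℂ (WickTensor b m) :=
  Finsupp.supported ℂ ℂ {w | ∀ k, (Finset.univ.filter fun i => w i = k).card = d k}

/-- Such tensors are spanned by words, and a product over the letters of a word depends only on its
multidegree. This turns wordwise scalars into one scalar for the whole space. -/
theorem wickHomogeneous_induction {b m : ℕ} {d : Fin b → ℕ} {P : WickTensor b m → Prop}
    (h0 : P 0) (hadd : ∀ X Y, P X → P Y → P (X + Y)) (hsmul : ∀ (c : ℂ) X, P X → P (c • X))
    (hw : ∀ w : Fin m → Fin b, Finsupp.single w 1 ∈ wickHomogeneous m d →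
      (∀ {M : Type} [CommMonoid M] (f : Fin b → M), ∏ i, f (w i) = ∏ k, f k ^ d k) →
        P (Finsupp.single w 1))
    {X : WickTensor b m} (hX : X ∈ wickHomogeneous m d) : P X := by
  rw [wickHomogeneous, Finsupp.supported_eq_span_single] at hX
  induction hX using Submodule.span_induction with
  | mem x hx =>
    obtain ⟨w, hwd, rfl⟩ := hx
    refine hw w (Finsupp.single_mem_supported ℂ _ hwd) fun f => ?_
    rw [← Finset.prod_fiberwise' Finset.univ w f]
    exact Finset.prod_congr rfl fun k _ => by rw [Finset.prod_const, hwd k]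
  | zero => exact h0
  | add x y _ _ hx hy => exact hadd x y hx hy
  | smul c x _ hx => exact hsmul c x hx

/-- The map `X ↦ e_j ⊗ X` from `H^{⊗n}` to `H^{⊗(n+1)}`. -/
noncomputable def wickPrepend {d n : ℕ} (j : Fin d) :
    WickTensor d n →ₗ[ℂ] WickTensor d (n + 1) :=
  Finsupp.lmapDomain ℂ ℂ fun w : Fin n → Fin d => Fin.cons (α := fun _ => Fin d) j w

theorem wickAppend_mem_wickHomogeneous {b m : ℕ} {d : Fin b → ℕ} (j : Fin b)
    {X : WickTensor b m} (hX : X ∈ wickHomogeneous m d) :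
    wickAppend j X ∈ wickHomogeneous (m + 1) (d + Pi.single j 1) := by
  have h := Submodule.mem_map_of_mem (f := wickAppend j) hX
  rw [wickHomogeneous, wickAppend, Finsupp.lmapDomain_supported] at h
  refine Finsupp.supported_mono ?_ h
  rintro _ ⟨w, hw, rfl⟩ k
  simp only [Finset.card_filter, Fin.sum_univ_castSucc, Fin.snoc_castSucc, Fin.snoc_last,
    Pi.add_apply, Pi.single_apply]
  rw [← Finset.card_filter, hw k]
  simp only [eq_comm]

theorem wickPrepend_mem_wickHomogeneous {b m : ℕ} {d : Fin b → ℕ} (j : Fin b)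
    {X : WickTensor b m} (hX : X ∈ wickHomogeneous m d) :
    wickPrepend j X ∈ wickHomogeneous (m + 1) (d + Pi.single j 1) := by
  have h := Submodule.mem_map_of_mem (f := wickPrepend j) hX
  rw [wickHomogeneous, wickPrepend, Finsupp.lmapDomain_supported] at h
  refine Finsupp.supported_mono ?_ h
  rintro _ ⟨w, hw, rfl⟩ k
  simp only [Finset.card_filter, Fin.sum_univ_succ, Fin.cons_zero, Fin.cons_succ,
    Pi.add_apply, Pi.single_apply]
  rw [← Finset.card_filter, hw k, add_comm]
  simp only [eq_comm]

/-- The scalar by which `e_j` commutes with tensors of multidegree `d`. -/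
noncomputable def quonWeight (q : ℝ) (lam : ℂ) (d : Fin 2 → ℕ) (j : Fin 2) : ℂ :=
  ∏ k, quonCoeff q lam k j ^ d k

theorem quonWeight_add_single (q : ℝ) (lam : ℂ) (d : Fin 2 → ℕ) (j k : Fin 2) :
    quonWeight q lam (d + Pi.single j 1) k = quonWeight q lam d k * quonCoeff q lam j k := by
  fin_cases j <;> simp [quonWeight, pow_succ] <;> ring

theorem norm_quonCoeff {q : ℝ} (hq0 : 0 < q) {lam : ℂ} (hlam : ‖lam‖ = 1) (k j : Fin 2) :
    ‖quonCoeff q lam k j‖ = if k = j then q else 1 := by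
  unfold quonCoeff
  split_ifs <;> simp [hlam, abs_of_pos hq0]

/-- Passing a different letter costs a phase; only the `d j` equal letters contribute a factor `q`.
-/
theorem norm_quonWeight {q : ℝ} (hq0 : 0 < q) {lam : ℂ} (hlam : ‖lam‖ = 1) (d : Fin 2 → ℕ)
    (j : Fin 2) : ‖quonWeight q lam d j‖ = q ^ d j := by
  simp only [quonWeight, norm_prod, norm_pow, norm_quonCoeff hq0 hlam, ite_pow, one_pow]
  simp

/-- The tensor `X ⊗ e_j - c e_j ⊗ X`, for `X` of multidegree `d` and `c` the weight of `d`. -/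
noncomputable def quonCommutator (q : ℝ) (lam : ℂ) {m : ℕ} (d : Fin 2 → ℕ) (j : Fin 2) :
    WickTensor 2 m →ₗ[ℂ] WickTensor 2 (m + 1) :=
  wickAppend j - quonWeight q lam d j • wickPrepend j

theorem wickProd_quonT_wickAppend (q : ℝ) (lam : ℂ) {m : ℕ} {d : Fin 2 → ℕ} (j : Fin 2)
    {X : WickTensor 2 m} (hX : X ∈ wickHomogeneous m d) :
    wickProd (quonT q lam) m m (wickAppend j X) =
      quonWeight q lam d j • wickPrepend j X := by
  refine wickHomogeneous_induction (P := fun X => wickProd (quonT q lam) m m (wickAppend j X) =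
    quonWeight q lam d j • wickPrepend j X) (by simp) (fun X Y hX hY => ?_) (fun c X hX => ?_)
    (fun w _ hf => ?_) hX
  · rw [map_add, map_add, hX, hY, map_add, smul_add]
  · rw [map_smul, map_smul, hX, map_smul, smul_comm]
  · rw [quonWeight, ← hf fun k => quonCoeff q lam k j, wickAppend, wickPrepend,
      Finsupp.lmapDomain_apply, Finsupp.lmapDomain_apply, Finsupp.mapDomain_single,
      Finsupp.mapDomain_single, wickProd_quonT_snoc]

/-- On a homogeneous `X`, the operator `1 - T_1 ⋯ T_m` sends `X ⊗ e_j` to exactly this weighted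
commutator. -/
theorem quonCommutator_mem_wickK (q : ℝ) (lam : ℂ) {n : ℕ} {d : Fin 2 → ℕ} (j : Fin 2)
    {X : WickTensor 2 (n + 2)} (hX : X ∈ wickHomogeneous (n + 2) d)
    (hK : X ∈ wickK (quonT q lam) (n + 2)) :
    quonCommutator q lam d j X ∈ wickK (quonT q lam) (n + 3) := by
  have h : wickAppend j X ∈ wickTensorRight (wickK (quonT q lam) (n + 2)) :=
    (le_iSup (fun j => (wickK (quonT q lam) (n + 2)).map (wickAppend j)) j)
      (Submodule.mem_map_of_mem hK)
  have h2 := Submodule.mem_map_of_mem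
    (f := (1 - wickProd (quonT q lam) (n + 2) (n + 2))) h
  rwa [LinearMap.sub_apply, Module.End.one_apply, wickProd_quonT_wickAppend q lam j hX] at h2

theorem quonCommutator_mem_wickHomogeneous (q : ℝ) (lam : ℂ) {m : ℕ} {d : Fin 2 → ℕ} (j : Fin 2)
    {X : WickTensor 2 m} (hX : X ∈ wickHomogeneous m d) :
    quonCommutator q lam d j X ∈ wickHomogeneous (m + 1) (d + Pi.single j 1) :=
  Submodule.sub_mem _ (wickAppend_mem_wickHomogeneous j hX)
    (Submodule.smul_mem _ _ (wickPrepend_mem_wickHomogeneous j hX))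

/-! ### Homogeneous polynomials in the quon algebra -/

theorem quonOfTensor_single (q : ℝ) (lam : ℂ) {m : ℕ} (w : Fin m → Fin 2) :
    quonOfTensor q lam m (Finsupp.single w 1) =
      (List.ofFn fun i => QuonAlgebra.a q lam (w i)).prod := by
  rw [quonOfTensor, Finsupp.linearCombination_single, one_smul]

theorem quonOfTensor_wickAppend (q : ℝ) (lam : ℂ) {m : ℕ} (j : Fin 2) (X : WickTensor 2 m) :
    quonOfTensor q lam (m + 1) (wickAppend j X) =
      quonOfTensor q lam m X * QuonAlgebra.a q lam j := by
  suffices h : quonOfTensor q lam (m + 1) ∘ₗ wickAppend j =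
      LinearMap.mulRight ℂ (QuonAlgebra.a q lam j) ∘ₗ quonOfTensor q lam m from
    LinearMap.congr_fun h X
  refine Finsupp.lhom_ext' fun w => LinearMap.ext_ring ?_
  simp only [LinearMap.comp_apply, Finsupp.lsingle_apply, wickAppend, Finsupp.lmapDomain_apply,
    Finsupp.mapDomain_single, quonOfTensor_single, LinearMap.mulRight_apply]
  rw [List.ofFn_succ', List.concat_eq_append, List.prod_append]
  simp

theorem quonOfTensor_wickPrepend (q : ℝ) (lam : ℂ) {m : ℕ} (j : Fin 2) (X : WickTensor 2 m) :
    quonOfTensor q lam (m + 1) (wickPrepend j X) =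
      QuonAlgebra.a q lam j * quonOfTensor q lam m X := by
  suffices h : quonOfTensor q lam (m + 1) ∘ₗ wickPrepend j =
      LinearMap.mulLeft ℂ (QuonAlgebra.a q lam j) ∘ₗ quonOfTensor q lam m from
    LinearMap.congr_fun h X
  refine Finsupp.lhom_ext' fun w => LinearMap.ext_ring ?_
  simp only [LinearMap.comp_apply, Finsupp.lsingle_apply, wickPrepend, Finsupp.lmapDomain_apply,
    Finsupp.mapDomain_single, quonOfTensor_single, LinearMap.mulLeft_apply]
  rw [List.ofFn_succ, List.prod_cons]
  simp

theorem quonOfTensor_quonCommutator (q : ℝ) (lam : ℂ) {m : ℕ} (d : Fin 2 → ℕ) (j : Fin 2)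
    (X : WickTensor 2 m) :
    quonOfTensor q lam (m + 1) (quonCommutator q lam d j X) =
      quonOfTensor q lam m X * QuonAlgebra.a q lam j -
        quonWeight q lam d j • (QuonAlgebra.a q lam j * quonOfTensor q lam m X) := by
  rw [quonCommutator, LinearMap.sub_apply, LinearMap.smul_apply, map_sub, map_smul,
    quonOfTensor_wickAppend, quonOfTensor_wickPrepend]

/-- If `y` commutes with the image of each `a_j` up to the scalar `c j`, it commutes with the image
of a homogeneous polynomial up to the corresponding product of scalars. -/
theorem mul_map_quonOfTensor {q : ℝ} {lam : ℂ} {E : Type*} [Ring E] [Algebra ℂ E]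
    (ρ : QuonAlgebra q lam →ₐ[ℂ] E) (y : E) (c : Fin 2 → ℂ)
    (hy : ∀ j, y * ρ (QuonAlgebra.a q lam j) = c j • (ρ (QuonAlgebra.a q lam j) * y))
    {m : ℕ} {d : Fin 2 → ℕ} {X : WickTensor 2 m} (hX : X ∈ wickHomogeneous m d) :
    y * ρ (quonOfTensor q lam m X) = (∏ k, c k ^ d k) • (ρ (quonOfTensor q lam m X) * y) := by
  have hword : ∀ l : List (Fin 2), y * ρ ((l.map (QuonAlgebra.a q lam)).prod) =
      (l.map c).prod • (ρ ((l.map (QuonAlgebra.a q lam)).prod) * y) := by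
    intro l
    induction l with
    | nil => simp
    | cons j l ih =>
      rw [List.map_cons, List.prod_cons, List.map_cons, List.prod_cons, map_mul, ← mul_assoc,
        hy, smul_mul_assoc, mul_assoc, ih, mul_smul_comm, mul_smul, mul_assoc]
  refine wickHomogeneous_induction (P := fun X => y * ρ (quonOfTensor q lam m X) =
    (∏ k, c k ^ d k) • (ρ (quonOfTensor q lam m X) * y)) (by simp) (fun X Y hX hY => ?_)
    (fun c X hX => ?_) (fun w _ hf => ?_) hX
  · rw [map_add, map_add, mul_add, hX, hY, add_mul, smul_add]
  · rw [map_smul, map_smul, mul_smul_comm, hX, smul_mul_assoc, smul_comm]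
  · have h := hword (List.ofFn w)
    rw [List.map_ofFn, List.map_ofFn, List.prod_ofFn (f := c ∘ w)] at h
    rw [quonOfTensor_single, ← hf c]
    exact h

/-- The elements `x` with `a_j^* x = c_j x a_j^*`, where `c` is the weight of the multidegree `d`. -/
def QuonAlgebra.IsWickCommuting {q : ℝ} {lam : ℂ} (d : Fin 2 → ℕ) (x : QuonAlgebra q lam) : Prop :=
  ∀ j, gen q lam (.aStar j) * x = quonWeight q lam d j • (x * gen q lam (.aStar j))

theorem QuonAlgebra.gen_aStar_mul_a (q : ℝ) (lam : ℂ) (k j : Fin 2) :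
    gen q lam (.aStar k) * a q lam j =
      (if j = k then 1 else 0) + quonCoeff q lam j k • (a q lam j * gen q lam (.aStar k)) := by
  unfold a
  fin_cases k <;> fin_cases j
  · simpa [quonCoeff] using gen_diag q lam 0
  · simpa [quonCoeff] using gen_off q lam
  · simpa [quonCoeff] using gen_offStar q lam
  · simpa [quonCoeff] using gen_diag q lam 1

/-- Moving `a_k^*` through `x a_j` and through `w_j a_j x` leaves the inhomogeneous terms `w_k
δ_{jk} x` and `w_j δ_{jk} x`, which cancel. What remains gains the factor `quonCoeff j k`, which is
the change of weight due to one more letter `j`. -/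
theorem QuonAlgebra.IsWickCommuting.commutator {q : ℝ} {lam : ℂ} {d : Fin 2 → ℕ}
    {x : QuonAlgebra q lam} (hx : IsWickCommuting d x) (j : Fin 2) :
    IsWickCommuting (d + Pi.single j 1)
      (x * a q lam j - quonWeight q lam d j • (a q lam j * x)) := by
  intro k
  have h := gen_aStar_mul_a q lam k j
  rw [quonWeight_add_single, mul_sub, ← mul_assoc, hx k, mul_smul_comm, ← mul_assoc, h,
    smul_mul_assoc, mul_assoc, h, mul_add, add_mul, mul_smul_comm, smul_mul_assoc,
    mul_assoc (a q lam j) (gen q lam (.aStar k)) x, hx k, mul_smul_comm, sub_mul,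
    smul_mul_assoc]
  have h2 : quonWeight q lam d k • (x * (if j = k then 1 else 0)) =
      quonWeight q lam d j • ((if j = k then 1 else 0) * x) := by
    split_ifs with hjk
    · rw [hjk, mul_one, one_mul]
    · simp
  rw [smul_add, smul_add, h2, add_sub_add_left_eq_sub]
  simp only [smul_sub, smul_smul, mul_assoc]
  congr 2
  ring

/-! ### The element `A` -/

/-- The tensor `e_2 ⊗ e_1 - lam e_1 ⊗ e_2`, which spans `K_2`. -/
noncomputable def quonTensorA (lam : ℂ) : WickTensor 2 2 :=
  Finsupp.single ![1, 0] 1 - lam • Finsupp.single ![0, 1] 1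

theorem quonOfTensor_quonTensorA (q : ℝ) (lam : ℂ) :
    quonOfTensor q lam 2 (quonTensorA lam) = quonA q lam := by
  rw [quonTensorA, map_sub, map_smul, quonOfTensor_single, quonOfTensor_single]
  simp [quonA, List.ofFn_succ]

theorem quonTensorA_mem_wickHomogeneous (lam : ℂ) :
    quonTensorA lam ∈ wickHomogeneous 2 (1 : Fin 2 → ℕ) := by
  refine Submodule.sub_mem _ (Finsupp.single_mem_supported ℂ _ ?_)
    (Submodule.smul_mem _ _ (Finsupp.single_mem_supported ℂ _ ?_)) <;>
  · intro k
    fin_cases k <;> decide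

theorem wickR_quonT_single (q : ℝ) (lam : ℂ) (w : Fin 2 → Fin 2) :
    wickR (quonT q lam) 1 (Finsupp.single w 1) =
      Finsupp.single w 1 + Finsupp.single ![w 1, w 0] (quonCoeff q lam (w 0) (w 1)) := by
  have h := wickProd_quonT_snoc q lam (n := 1) (w 1) ![w 0]
  have h1 : Fin.snoc (α := fun _ => Fin 2) ![w 0] (w 1) = w := by
    funext k; fin_cases k <;> rfl
  have h2 : Fin.cons (α := fun _ => Fin 2) (w 1) ![w 0] = ![w 1, w 0] := rfl
  rw [h1, h2] at h
  rw [wickR, Finset.sum_range_succ, Finset.sum_range_one, wickProd_zero, LinearMap.add_apply, h]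
  simp

theorem quonTensorA_mem_wickK (q : ℝ) {lam : ℂ} (hlam : ‖lam‖ = 1) :
    quonTensorA lam ∈ wickK (quonT q lam) 2 := by
  have h : lam * (starRingEnd ℂ) lam = 1 := by simp [Complex.mul_conj', hlam]
  rw [wickK, LinearMap.mem_ker, quonTensorA, map_sub, map_smul, wickR_quonT_single,
    wickR_quonT_single]
  simp [quonCoeff, h]
  abel

/-- `R_2` multiplies `e_i ⊗ e_i` by `1 + q ≠ 0`, and its `e_1 ⊗ e_2` coordinate ties the two mixed
coefficients together. -/
theorem mem_span_quonTensorA {q : ℝ} (hq0 : 0 < q) {lam : ℂ} {X : WickTensor 2 2}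
    (hX : X ∈ wickK (quonT q lam) 2) : X = X ![1, 0] • quonTensorA lam := by
  have hq : (1 + q : ℂ) ≠ 0 := by exact_mod_cast (by positivity : (1 + q : ℝ) ≠ 0)
  have hsum : X = X ![0, 0] • Finsupp.single ![0, 0] 1 + X ![0, 1] • Finsupp.single ![0, 1] 1 +
      X ![1, 0] • Finsupp.single ![1, 0] 1 + X ![1, 1] • Finsupp.single ![1, 1] 1 := by
    ext w
    obtain ⟨i, j, rfl⟩ : ∃ i j, w = ![i, j] := ⟨w 0, w 1, by funext k; fin_cases k <;> rfl⟩
    fin_cases i <;> fin_cases j <;> simp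
  rw [wickK, LinearMap.mem_ker, hsum] at hX
  simp only [map_add, map_smul, wickR_quonT_single] at hX
  have h00 := DFunLike.congr_fun hX ![0, 0]
  have h01 := DFunLike.congr_fun hX ![0, 1]
  have h11 := DFunLike.congr_fun hX ![1, 1]
  simp [quonCoeff] at h00 h01 h11
  have e0 : X ![0, 0] = 0 := by
    refine (mul_eq_zero.1 (?_ : X ![0, 0] * (1 + q : ℂ) = 0)).resolve_right hq
    linear_combination h00
  have e1 : X ![1, 1] = 0 := by
    refine (mul_eq_zero.1 (?_ : X ![1, 1] * (1 + q : ℂ) = 0)).resolve_right hq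
    linear_combination h11
  have e2 : X ![0, 1] = -(X ![1, 0] * lam) := by linear_combination h01
  conv_lhs => rw [hsum, e0, e1, e2]
  rw [quonTensorA, smul_sub, smul_smul]
  module

/-- The terms of degree one cancel: both products give `lam a_2` for `a_1^*`, and both give `a_1`
for `a_2^*`, the latter because `lam * conj lam = 1`. -/
theorem quonA_isWickCommuting (q : ℝ) {lam : ℂ} (hlam : ‖lam‖ = 1) :
    QuonAlgebra.IsWickCommuting 1 (quonA q lam) := by
  have hl : lam * (starRingEnd ℂ) lam = 1 := by simp [Complex.mul_conj', hlam]
  have h00 := QuonAlgebra.gen_aStar_mul_a q lam 0 0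
  have h01 := QuonAlgebra.gen_aStar_mul_a q lam 0 1
  have h10 := QuonAlgebra.gen_aStar_mul_a q lam 1 0
  have h11 := QuonAlgebra.gen_aStar_mul_a q lam 1 1
  simp [quonCoeff] at h00 h01 h10 h11
  intro j
  rw [quonA, mul_sub, mul_smul_comm, ← mul_assoc, ← mul_assoc]
  fin_cases j
  · simp only [Fin.zero_eta, h00, h01]
    rw [smul_mul_assoc, mul_assoc, h00, add_mul, smul_mul_assoc, mul_assoc _ _ (_ : _), h01]
    simp [quonWeight, quonCoeff, mul_add, sub_mul, smul_smul, mul_assoc, smul_sub]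
    module
  · simp only [Fin.mk_one, h10, h11]
    rw [smul_mul_assoc, mul_assoc _ _ (QuonAlgebra.a q lam 1), h11, add_mul, smul_mul_assoc,
      mul_assoc _ _ (QuonAlgebra.a q lam 0), h10]
    simp [quonWeight, quonCoeff, mul_add, sub_mul, smul_smul, mul_assoc, smul_sub, hl]
    have h3 : (starRingEnd ℂ) lam * ((q : ℂ) * lam) = q := by
      rw [mul_left_comm, mul_comm _ lam, hl, mul_one]
    simp only [h3]
    module

/-! ### `*`-representations -/

theorem UnboundedStarRep.toAlgHom_eq_zero_of_star_mul_self {A : Type*} [Ring A] [Algebra ℂ A]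
    [StarRing A] {H : Type*} [NormedAddCommGroup H] [InnerProductSpace ℂ H]
    (π : UnboundedStarRep A H) {x : A} (h : π.toAlgHom (star x * x) = 0) : π.toAlgHom x = 0 := by
  refine LinearMap.ext fun φ => ?_
  have h1 := π.inner_apply x φ (π.toAlgHom x φ)
  rw [← Module.End.mul_apply, ← map_mul, h, LinearMap.zero_apply, ZeroMemClass.coe_zero,
    inner_zero_right, inner_self_eq_zero] at h1
  exact Subtype.ext h1

/-- A homogeneous Wick commuting polynomial vanishes in every `*`-representation in which it also
commutes with the `a_j` up to its weight. -/
theorem UnboundedStarRep.toAlgHom_quonOfTensor_eq_zero {q : ℝ} (hq0 : 0 < q) (hq1 : q < 1)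
    {lam : ℂ} (hlam : ‖lam‖ = 1) {H : Type*} [NormedAddCommGroup H] [InnerProductSpace ℂ H]
    (π : UnboundedStarRep (QuonAlgebra q lam) H) {m : ℕ} {d : Fin 2 → ℕ} (hd : d ≠ 0)
    {X : WickTensor 2 m} (hX : X ∈ wickHomogeneous m d)
    (hW : QuonAlgebra.IsWickCommuting d (quonOfTensor q lam m X))
    (h : ∀ j, π.toAlgHom (quonOfTensor q lam (m + 1) (quonCommutator q lam d j X)) = 0) :
    π.toAlgHom (quonOfTensor q lam m X) = 0 := by
  set x := quonOfTensor q lam m X with hx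
  have hcomm : ∀ j, π.toAlgHom x * π.toAlgHom (QuonAlgebra.a q lam j) =
      quonWeight q lam d j • (π.toAlgHom (QuonAlgebra.a q lam j) * π.toAlgHom x) := by
    intro j
    have hj := h j
    rwa [quonOfTensor_quonCommutator, map_sub, sub_eq_zero, map_smul, map_mul, map_mul] at hj
  -- This is the adjoint of the Wick relation, so it already holds in the algebra.
  have hstar : ∀ j, π.toAlgHom (star x) * π.toAlgHom (QuonAlgebra.a q lam j) =
      (starRingEnd ℂ) (quonWeight q lam d j) •
        (π.toAlgHom (QuonAlgebra.a q lam j) * π.toAlgHom (star x)) := by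
    intro j
    have hj := congrArg (fun y => π.toAlgHom (star y)) (hW j)
    simpa [star_mul, QuonAlgebra.star_gen, QuonGen.swap, star_smul, QuonAlgebra.a] using hj
  -- The polynomial moved past is `x` itself: `h1` compares `x x` with itself, `h2` compares `x^* x`
  -- with `x x^*`.
  have h1 := mul_map_quonOfTensor π.toAlgHom _ _ hcomm hX
  have h2 := mul_map_quonOfTensor π.toAlgHom _ _ hstar hX
  rw [← hx] at h1 h2
  have hs : (∏ k, quonWeight q lam d k ^ d k) ≠ 1 := by
    intro hs
    have hn := congrArg norm hs
    simp only [norm_prod, norm_pow, norm_quonWeight hq0 hlam, ← pow_mul, norm_one,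
      Finset.prod_pow_eq_pow_sum] at hn
    obtain ⟨k, hk⟩ := Function.ne_iff.1 hd
    have hpos : ∑ k, d k * d k ≠ 0 := fun h0 =>
      hk (by simpa using (Finset.sum_eq_zero_iff.1 h0) k (Finset.mem_univ k))
    exact (pow_lt_one₀ hq0.le hq1 hpos).ne hn
  have hsq : π.toAlgHom x * π.toAlgHom x = 0 := by
    by_contra h0
    exact hs (smul_left_injective ℂ h0 (by simpa using h1.symm))
  -- Applied to `x` and then to the self-adjoint `x^* x`, this leaves `(x^* x)² = 0` to prove.
  apply π.toAlgHom_eq_zero_of_star_mul_self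
  apply π.toAlgHom_eq_zero_of_star_mul_self
  rw [star_mul, star_star]
  simp only [map_mul]
  rw [h2, smul_mul_smul_comm, ← mul_assoc, mul_assoc (π.toAlgHom x) (π.toAlgHom (star x)), h2,
    mul_smul_comm, ← mul_assoc, hsq]
  simp

theorem mainTheorem5 (q : ℝ) (hq0 : 0 < q) (hq1 : q < 1) (lam : ℂ) (hlam : ‖lam‖ = 1)
    {H : Type*} [NormedAddCommGroup H] [InnerProductSpace ℂ H] [CompleteSpace H]
    (π : UnboundedStarRep (QuonAlgebra q lam) H) (hπ : π.IsIrreducible)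
    (m : ℕ) (hm : 3 ≤ m)
    (hK : ∀ X ∈ wickK (quonT q lam) m, π.toAlgHom (quonOfTensor q lam m X) = 0) :
    π.toAlgHom (quonA q lam) = 0 ∧
      ∀ X ∈ wickK (quonT q lam) 2, π.toAlgHom (quonOfTensor q lam 2 X) = 0 := by
  obtain ⟨n, rfl⟩ := Nat.exists_eq_add_of_le' ((by norm_num : 2 ≤ 3).trans hm)
  -- The descent must cover all homogeneous Wick commuting tensors of each `K_{l+2}`, since one step
  -- up replaces `X` by its commutators.
  have hdown : ∀ X ∈ wickK (quonT q lam) (0 + 2), ∀ d : Fin 2 → ℕ, d ≠ 0 →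
      X ∈ wickHomogeneous (0 + 2) d →
      QuonAlgebra.IsWickCommuting d (quonOfTensor q lam (0 + 2) X) →
        π.toAlgHom (quonOfTensor q lam (0 + 2) X) = 0 := by
    refine Nat.decreasingInduction (n := n) (motive := fun l _ =>
      ∀ X ∈ wickK (quonT q lam) (l + 2), ∀ d : Fin 2 → ℕ, d ≠ 0 →
        X ∈ wickHomogeneous (l + 2) d →
        QuonAlgebra.IsWickCommuting d (quonOfTensor q lam (l + 2) X) →
          π.toAlgHom (quonOfTensor q lam (l + 2) X) = 0)
      (fun l _ ih X hX d hd hXd hW => ?_) (fun X hX _ _ _ _ => hK X hX) (Nat.zero_le n)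
    refine π.toAlgHom_quonOfTensor_eq_zero hq0 hq1 hlam hd hXd hW fun j => ?_
    refine ih _ (quonCommutator_mem_wickK q lam j hXd hX) (d + Pi.single j 1) ?_
      (quonCommutator_mem_wickHomogeneous q lam j hXd) ?_
    · exact fun h => by simpa using congrFun h j
    · exact quonOfTensor_quonCommutator q lam d j X ▸ hW.commutator j
  have hA : π.toAlgHom (quonA q lam) = 0 := by
    have h := hdown (quonTensorA lam) (quonTensorA_mem_wickK q hlam) 1 one_ne_zero
      (quonTensorA_mem_wickHomogeneous lam)
    rw [quonOfTensor_quonTensorA] at h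
    exact h (quonA_isWickCommuting q hlam)
  refine ⟨hA, fun X hX => ?_⟩
  rw [mem_span_quonTensorA hq0 hX, map_smul, map_smul, quonOfTensor_quonTensorA, hA, smul_zero]
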